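/- For complex $s$ with $\mathrm{Re}(s)>0$ and $x\in\mathbb{C}\setminus[1,\infty)$ let $$\mathrm{Li}_s(x)=\frac{x}{\Gamma(s)}\int_0^\infty\frac{t^{s-1}}{e^t-x}\,dt$$ be the principal branch of the polylogarithm, that is, the analytic continuation to $\mathbb{C}\setminus[1,\infty)$ of the power series $\sum_{n\ge1}x^n/n^s$, $|x|<1$. Let $\ln$ be the principal branch of the logarithm and let $w^s=e^{s\ln w}$. Then for every fixed complex $s$ with $\mathrm{Re}(s)>0$, $$\mathrm{Li}_s(x)=-\frac{(\ln(-x))^s}{\Gamma(s+1)}\,\bigl(1+o(1)\bigr)\qquad\text{as } |x|\to\infty,\ x\notin[0,\infty),$$ that is, $\mathrm{Li}_s(x)\sim-(\ln(-x))^s/\Gamma(s+1)$, uniformly in the direction of $x$. If moreover $\mathrm{Re}(s)<2$, then the difference itself tends to zero: $$\mathrm{Li}_s(x)=-\frac{(\ln(-x))^s}{\Gamma(s+1)}+o(1)\qquad\text{as } |x|\to\infty,\ x\notin[0,\infty).$$ -/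

import Mathlib

open Filter Asymptotics
open scoped Topology

/-- The (principal branch of the) polylogarithm of order `s`, for `0 < re s` and `x ∉ [1, ∞)`, given by
`Li_s(x) = x / Γ(s) * ∫_0^∞ t^(s-1) / (e^t - x) dt`. The integral converges absolutely there, and it is the
analytic continuation to `ℂ ∖ [1, ∞)` of the power series `∑_{n ≥ 1} x^n / n^s`
(see `polylog_hasSum` for the unit disc). -/
noncomputable def polylog (s x : ℂ) : ℂ :=
  x / Complex.Gamma s * ∫ t in Set.Ioi (0 : ℝ), (t : ℂ) ^ (s - 1) / (Complex.exp t - x)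

/-- `|x| → ∞` with `x ∈ ℂ ∖ [0, ∞)`. -/
noncomputable def toInftyOffRay : Filter ℂ :=
  comap (fun x : ℂ => ‖x‖) atTop ⊓ 𝓟 {x : ℂ | ∀ r : ℝ, 0 ≤ r → x ≠ (r : ℂ)}

/-- On the unit disc, `polylog` is the sum of the defining power series. -/
theorem polylog_hasSum (s x : ℂ) (hs : 0 < s.re) (hx : ‖x‖ < 1) :
    HasSum (fun n : ℕ => x ^ (n + 1) / ((n : ℂ) + 1) ^ s) (polylog s x) := by
  have hG : Complex.Gamma s ≠ 0 := Complex.Gamma_ne_zero_of_re_pos hs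
  have key : HasSum (fun n : ℕ => Complex.Gamma s * x ^ (n + 1) / (((n : ℝ) + 1 : ℝ) : ℂ) ^ s)
      (mellin (fun t : ℝ => x / (Complex.exp t - x)) s) := by
    refine hasSum_mellin (a := fun n : ℕ => x ^ (n + 1)) (p := fun n : ℕ => (n : ℝ) + 1)
      (fun n => Or.inr (by positivity)) hs ?_ ?_
    · intro t ht
      have ht : (0 : ℝ) < t := ht
      have he : ‖x * Complex.exp (-(t : ℂ))‖ < 1 := by
        rw [norm_mul, Complex.norm_exp]
        have : Real.exp (-(t : ℂ)).re ≤ 1 := by simp [ht.le]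
        nlinarith [norm_nonneg x, Real.exp_pos (-(t : ℂ)).re]
      have h := (hasSum_geometric_of_norm_lt_one he).mul_left (x * Complex.exp (-(t : ℂ)))
      have hne : Complex.exp t - x ≠ 0 := by
        intro h0
        have h1 : ‖x‖ = Real.exp t := by
          rw [← sub_eq_zero.mp h0, Complex.norm_exp]; simp
        have := Real.add_one_le_exp t
        linarith
      have hv : x / (Complex.exp t - x)
          = x * Complex.exp (-(t : ℂ)) * (1 - x * Complex.exp (-(t : ℂ)))⁻¹ := by
        rw [Complex.exp_neg]
        have := Complex.exp_ne_zero (t : ℂ)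
        have h2 : 1 - x * (Complex.exp (t : ℂ))⁻¹ ≠ 0 := by
          intro h0
          apply hne
          field_simp at h0
          simpa using h0
        field_simp
      rw [hv]
      refine (congrArg (fun f => HasSum f _) (funext fun n => ?_)).mpr h
      rw [mul_pow, ← Complex.exp_nat_mul]
      have : ((Real.exp (-((n : ℝ) + 1) * t) : ℝ) : ℂ)
          = Complex.exp (-(t : ℂ)) * Complex.exp (n * -(t : ℂ)) := by
        rw [← Complex.exp_add]
        push_cast
        congr 1
        ring
      rw [this]
      ring
    · refine Summable.of_nonneg_of_le (fun n => by positivity) (fun n => ?_)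
        ((summable_geometric_of_lt_one (norm_nonneg x) hx).mul_left ‖x‖)
      rw [norm_pow, pow_succ, mul_comm ‖x‖]
      exact div_le_self (by positivity) (Real.one_le_rpow (by linarith [n.cast_nonneg (α := ℝ)]) hs.le)
  have h2 := key.mul_left (Complex.Gamma s)⁻¹
  have h3 : polylog s x = (Complex.Gamma s)⁻¹ * mellin (fun t : ℝ => x / (Complex.exp t - x)) s := by
    rw [polylog, mellin, div_eq_mul_inv, mul_comm x, mul_assoc, ← MeasureTheory.integral_const_mul]
    congr 2
    funext t
    simp only [smul_eq_mul]
    ring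
  rw [h3]
  refine (congrArg (fun f => HasSum f _) (funext fun n => ?_)).mpr h2
  push_cast
  field_simp

/-! Put y = -x and l = log ‖y‖. Then -Γ(s) Li_s(x) = ∫ t^(s-1) y/(e^t + y) dt, and the kernel is
close to the step function that drops from 1 to 0 at t = l. It may blow up near t = l when y
approaches the negative axis, so l^(s-1) is first subtracted from t^(s-1). The subtracted part is
exact, because the kernel alone integrates to log(1 + y); the difference vanishes at t = l and tames
the blow-up. This gives l^s/s + l^(s-1) (log(1+y) - l) + R (`integral_cpow_mul_div_exp_add`), with R
= O(l^(re s - 2)) uniformly in arg y (`exists_norm_integral_stepRemainder_le`).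

Up to the same error, the explicit terms are the first-order Taylor expansion of (log y)^s/s about
l, since log y - l = i arg y is bounded. The total error is two powers of l below the main term, and
tends to zero when re s < 2. -/

/-! ### The kernel y/(e^t + y): integrability and exact integral -/

theorem exists_mul_exp_le_norm_exp_add {y : ℂ} (hy : y ∈ Complex.slitPlane) :
    ∃ c : ℝ, 0 < c ∧ ∀ t : ℝ, 0 ≤ t → c * Real.exp t ≤ ‖Complex.exp t + y‖ := by
  -- With r = e^(-t), the ratio (e^t + y)/e^t is 1 + y r, which has no zero on the compact interval
  -- [0, 1].
  obtain ⟨r, hr, hmin⟩ := isCompact_Icc.exists_isMinOn (Set.nonempty_Icc.mpr zero_le_one)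
    (f := fun r : ℝ => ‖1 + y * (r : ℂ)‖) (s := Set.Icc (0 : ℝ) 1) (by fun_prop)
  refine ⟨‖1 + y * (r : ℂ)‖, norm_pos_iff.mpr fun h0 => ?_, fun t ht => ?_⟩
  · rcases hr.1.eq_or_lt with h | h
    · simp [← h] at h0
    · rw [Complex.mem_slitPlane_iff] at hy
      have h1 := congrArg Complex.re h0
      have h2 := congrArg Complex.im h0
      simp at h1 h2
      rcases hy with hy | hy
      · nlinarith
      · rcases h2 with h2 | h2
        · exact hy h2
        · exact h.ne' h2
  · have h : Real.exp (-t) ∈ Set.Icc (0 : ℝ) 1 := ⟨(Real.exp_pos _).le, by simpa using ht⟩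
    have h1 : ‖1 + y * (r : ℂ)‖ ≤ ‖1 + y * (Real.exp (-t) : ℝ)‖ := hmin h
    have h2 : Complex.exp t + y = (1 + y * (Real.exp (-t) : ℝ)) * Complex.exp t := by
      push_cast
      rw [add_mul, mul_assoc, ← Complex.exp_add]
      simp
    rw [h2, norm_mul, Complex.norm_exp, Complex.ofReal_re]
    gcongr

theorem exp_add_ne_zero_of_mem_slitPlane {y : ℂ} (hy : y ∈ Complex.slitPlane) {t : ℝ} (ht : 0 ≤ t) :
    Complex.exp t + y ≠ 0 := by
  obtain ⟨c, hc, h⟩ := exists_mul_exp_le_norm_exp_add hy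
  exact norm_pos_iff.mp ((mul_pos hc (Real.exp_pos t)).trans_le (h t ht))

theorem continuousOn_div_exp_add {y : ℂ} (hy : y ∈ Complex.slitPlane) :
    ContinuousOn (fun t : ℝ => y / (Complex.exp t + y)) (Set.Ioi 0) :=
  ContinuousOn.div (by fun_prop) (by fun_prop)
    fun t ht => exp_add_ne_zero_of_mem_slitPlane hy (le_of_lt ht)

theorem continuousOn_ofReal_cpow (w : ℂ) :
    ContinuousOn (fun t : ℝ => (t : ℂ) ^ w) (Set.Ioi 0) := fun t ht =>
  (Complex.continuousAt_ofReal_cpow_const t w (Or.inr (ne_of_gt ht))).continuousWithinAt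

theorem integrableOn_cpow_mul_div_exp_add {s y : ℂ} (hs : 0 < s.re) (hy : y ∈ Complex.slitPlane) :
    MeasureTheory.IntegrableOn (fun t : ℝ => (t : ℂ) ^ (s - 1) * (y / (Complex.exp t + y)))
      (Set.Ioi 0) := by
  obtain ⟨c, hc, h⟩ := exists_mul_exp_le_norm_exp_add hy
  have hg := ((Real.GammaIntegral_convergent hs).const_mul (‖y‖ / c))
  refine MeasureTheory.Integrable.mono' hg
    (((continuousOn_ofReal_cpow _).mul (continuousOn_div_exp_add hy)).aestronglyMeasurable
      measurableSet_Ioi) ?_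
  refine (MeasureTheory.ae_restrict_iff' measurableSet_Ioi).mpr (.of_forall fun t ht => ?_)
  have ht0 : 0 < t := ht
  have := h t ht0.le
  rw [norm_mul, Complex.norm_cpow_eq_rpow_re_of_pos ht0, norm_div, Real.exp_neg]
  have h1 : ‖y‖ / ‖Complex.exp t + y‖ ≤ ‖y‖ / (c * Real.exp t) := by
    gcongr
  have h2 : 0 ≤ t ^ (s.re - 1) := by positivity
  calc t ^ (s - 1).re * (‖y‖ / ‖Complex.exp t + y‖)
      ≤ t ^ (s.re - 1) * (‖y‖ / (c * Real.exp t)) := by simpa using mul_le_mul_of_nonneg_left h1 h2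
    _ = _ := by field_simp

theorem integrableOn_div_exp_add {y : ℂ} (hy : y ∈ Complex.slitPlane) :
    MeasureTheory.IntegrableOn (fun t : ℝ => y / (Complex.exp t + y)) (Set.Ioi 0) := by
  simpa using integrableOn_cpow_mul_div_exp_add (s := 1) (by simp) hy

/-- The antiderivative -log(1 + y e^(-t)) meets no branch cut, as its argument stays in the slit
plane. -/
theorem integral_div_exp_add {y : ℂ} (hy : y ∈ Complex.slitPlane) :
    ∫ t in Set.Ioi (0 : ℝ), y / (Complex.exp t + y) = Complex.log (1 + y) := by
  have hsl : ∀ t : ℝ, 1 + y * Complex.exp (-(t : ℂ)) ∈ Complex.slitPlane := fun t => by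
    have h1 : Complex.exp (-(t : ℂ)) = ((Real.exp (-t) : ℝ) : ℂ) := by push_cast; rfl
    have h2 := Real.exp_pos (-t)
    rw [h1]
    rw [Complex.mem_slitPlane_iff] at hy ⊢
    simp only [Complex.add_re, Complex.one_re, Complex.re_mul_ofReal, Complex.add_im,
      Complex.one_im, Complex.im_mul_ofReal, zero_add]
    rcases hy with hy | hy
    · left; positivity
    · right; exact mul_ne_zero hy h2.ne'
  have hderiv : ∀ t ∈ Set.Ici (0 : ℝ), HasDerivAt
      (fun t : ℝ => -Complex.log (1 + y * Complex.exp (-(t : ℂ)))) (y / (Complex.exp t + y)) t := by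
    intro t ht
    have h1 : HasDerivAt (fun t : ℝ => 1 + y * Complex.exp (-(t : ℂ)))
        (y * (Complex.exp (-(t : ℂ)) * -1)) t :=
      ((Complex.ofRealCLM.hasDerivAt (x := t)).neg.cexp.const_mul y).const_add 1
    have h2 := (h1.clog_real (hsl t)).neg
    refine h2.congr_deriv ?_
    have h3 := exp_add_ne_zero_of_mem_slitPlane hy ht
    have h4 := Complex.slitPlane_ne_zero (hsl t)
    have h5 := Complex.exp_ne_zero (t : ℂ)
    rw [Complex.exp_neg] at h4 ⊢
    field_simp
  have hlim : Tendsto (fun t : ℝ => -Complex.log (1 + y * Complex.exp (-(t : ℂ)))) atTop (𝓝 0) := by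
    have h1 : Tendsto (fun t : ℝ => Complex.exp (-(t : ℂ))) atTop (𝓝 0) := by
      have := (Complex.continuous_ofReal.tendsto 0).comp Real.tendsto_exp_neg_atTop_nhds_zero
      simpa [Function.comp_def] using this
    have h2 : Tendsto (fun t : ℝ => 1 + y * Complex.exp (-(t : ℂ))) atTop (𝓝 1) := by
      simpa using (h1.const_mul y).const_add 1
    simpa using (h2.clog (by simp)).neg
  have := MeasureTheory.integral_Ioi_of_hasDerivAt_of_tendsto' hderiv (integrableOn_div_exp_add hy) hlim
  simpa using this

/-! ### Pointwise estimates for the kernel and for powers -/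

/-- The reverse triangle inequality ‖e^t + y‖ ≥ |e^t - e^l| sees only ‖y‖, hence the uniformity in
direction. The weight |t - l| absorbs the zero of this lower bound. -/
theorem norm_div_exp_add_sub_indicator_mul_le {y : ℂ} (hy : y ≠ 0) (t : ℝ) :
    ‖y / (Complex.exp t + y) - (Set.Iio (Real.log ‖y‖)).indicator 1 t‖ * |t - Real.log ‖y‖|
      ≤ Real.exp (-(|t - Real.log ‖y‖| / 2)) := by
  set l := Real.log ‖y‖ with hl
  have hyn : ‖y‖ = Real.exp l := (Real.exp_log (norm_pos_iff.mpr hy)).symm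
  -- This is 2 sinh(v/2) ≥ v multiplied by e^(v/2).
  have hexp : ∀ v : ℝ, 0 < v → v * Real.exp (v / 2) ≤ Real.exp v - 1 := fun v hv => by
    have h1 : v / 2 < Real.sinh (v / 2) := Real.self_lt_sinh_iff.mpr (by positivity)
    rw [Real.sinh_eq] at h1
    have h2 : Real.exp v = Real.exp (v / 2) * Real.exp (v / 2) := by rw [← Real.exp_add]; ring_nf
    have h3 : Real.exp (v / 2) * Real.exp (-(v / 2)) = 1 := by rw [← Real.exp_add]; simp
    nlinarith [Real.exp_pos (v / 2)]
  have key : ∀ v d : ℝ, 0 < v → Real.exp v - 1 ≤ d → 1 / d * v ≤ Real.exp (-(v / 2)) := by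
    intro v d hv hd
    have h1 := hexp v hv
    have h2 : 0 < v * Real.exp (v / 2) := by positivity
    have h3 : 0 < d := by linarith
    rw [Real.exp_neg, div_mul_eq_mul_div, one_mul, div_le_iff₀ h3, inv_mul_eq_div, le_div_iff₀ (by positivity)]
    linarith
  have hne : ‖Complex.exp t‖ = Real.exp t := by rw [Complex.norm_exp, Complex.ofReal_re]
  rcases lt_trichotomy t l with h | h | h
  · have hlow : Real.exp l - Real.exp t ≤ ‖Complex.exp t + y‖ := by
      have := norm_sub_norm_le y (-Complex.exp t)
      rw [norm_neg, hne, hyn, sub_neg_eq_add, add_comm y] at this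
      exact this
    have hlt := Real.exp_lt_exp.mpr h
    have hne0 : Complex.exp t + y ≠ 0 := norm_pos_iff.mp (by linarith)
    have hF : y / (Complex.exp t + y) - 1 = -(Complex.exp t / (Complex.exp t + y)) := by
      field_simp; ring
    rw [Set.indicator_of_mem (show t ∈ Set.Iio l from h), Pi.one_apply, hF, norm_neg, norm_div, hne,
      abs_of_neg (by linarith : t - l < 0), neg_sub,
      show Real.exp t / ‖Complex.exp t + y‖ = 1 / (‖Complex.exp t + y‖ / Real.exp t) by
        rw [one_div_div]]
    refine key _ _ (by linarith) ?_
    rw [le_div_iff₀ (Real.exp_pos t), Real.exp_sub, sub_mul, div_mul_cancel₀ _ (Real.exp_pos t).ne']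
    linarith
  · simp [h]
  · have hlow : Real.exp t - Real.exp l ≤ ‖Complex.exp t + y‖ := by
      have := norm_sub_norm_le (Complex.exp t) (-y)
      rw [norm_neg, hne, hyn, sub_neg_eq_add] at this
      exact this
    have hlt := Real.exp_lt_exp.mpr h
    rw [Set.indicator_of_notMem (by simpa using h.le), sub_zero, norm_div, hyn,
      abs_of_pos (by linarith : 0 < t - l),
      show Real.exp l / ‖Complex.exp t + y‖ = 1 / (‖Complex.exp t + y‖ / Real.exp l) by
        rw [one_div_div]]
    refine key _ _ (by linarith) ?_
    rw [le_div_iff₀ (Real.exp_pos l), Real.exp_sub, sub_mul, div_mul_cancel₀ _ (Real.exp_pos l).ne']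
    linarith

/-- Polynomial growth is paid for with half of the decay e^(-w/2). Taking N = 4b + 1 in 1 + w ≤ N
e^(w/N) makes b/N ≤ 1/4 and keeps N positive at b = 0. -/
theorem rpow_two_mul_one_add_le_mul_exp {b w : ℝ} (hb : 0 ≤ b) (hw : 0 ≤ w) :
    (2 * (1 + w)) ^ b ≤ (2 * (4 * b + 1)) ^ b * Real.exp (w / 4) := by
  have hN : 0 < 4 * b + 1 := by positivity
  have h1 : 1 + w ≤ (4 * b + 1) * Real.exp (w / (4 * b + 1)) := by
    have := Real.add_one_le_exp (w / (4 * b + 1))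
    have h2 : (4 * b + 1) * (w / (4 * b + 1) + 1) = w + (4 * b + 1) := by field_simp
    nlinarith
  calc (2 * (1 + w)) ^ b ≤ (2 * (4 * b + 1) * Real.exp (w / (4 * b + 1))) ^ b := by
        exact Real.rpow_le_rpow (by positivity) (by linarith) hb
    _ = (2 * (4 * b + 1)) ^ b * Real.exp (w / (4 * b + 1) * b) := by
        rw [Real.mul_rpow (by positivity) (Real.exp_pos _).le, ← Real.exp_mul]
    _ ≤ _ := by
        gcongr
        rw [div_mul_eq_mul_div, div_le_div_iff₀ hN (by norm_num)]
        nlinarith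

theorem rpow_le_rpow_abs_of_inv_le {q Q b : ℝ} (hq : 0 < q) (h1 : q ≤ Q) (h2 : q⁻¹ ≤ Q) :
    q ^ b ≤ Q ^ |b| := by
  rcases le_total 0 b with hb | hb
  · rw [abs_of_nonneg hb]
    exact Real.rpow_le_rpow hq.le h1 hb
  · rw [abs_of_nonpos hb, ← neg_neg b, Real.rpow_neg hq.le, ← Real.inv_rpow hq.le, neg_neg]
    exact Real.rpow_le_rpow (by positivity) h2 (by linarith)

theorem hasDerivAt_ofReal_cpow {t : ℝ} (ht : 0 < t) (a : ℂ) :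
    HasDerivAt (fun r : ℝ => (r : ℂ) ^ a) (a * (t : ℂ) ^ (a - 1)) t := by
  have := (hasDerivAt_id (t : ℂ)).cpow_const (c := a) (Or.inl (by simpa using ht))
  simpa using this.comp_ofReal

/-- Mean value inequality: for r between l and t, both r/l and l/r are at most 2(1 + |t - l|), which
handles either sign of the exponent re a - 1. -/
theorem norm_ofReal_cpow_sub_le (a : ℂ) {l t : ℝ} (hl : 1 ≤ l) (ht : l / 2 ≤ t) :
    ‖(t : ℂ) ^ a - (l : ℂ) ^ a‖ ≤
      ‖a‖ * ((2 * (1 + |t - l|)) ^ |a.re - 1| * l ^ (a.re - 1)) * |t - l| := by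
  have hl0 : 0 < l := by linarith
  have hpos : ∀ r ∈ Set.uIcc l t, 0 < r ∧ l ≤ 2 * r ∧ r ≤ l + |t - l| := fun r hr => by
    rcases Set.mem_uIcc.mp hr with h | h
    · have := le_abs_self (t - l)
      exact ⟨by linarith, by linarith, by linarith⟩
    · have := abs_nonneg (t - l)
      exact ⟨by linarith, by linarith, by linarith⟩
  have := (convex_uIcc l t).norm_image_sub_le_of_norm_hasDerivWithin_le
    (f := fun r : ℝ => (r : ℂ) ^ a) (f' := fun r => a * (r : ℂ) ^ (a - 1))
    (C := ‖a‖ * ((2 * (1 + |t - l|)) ^ |a.re - 1| * l ^ (a.re - 1)))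
    (fun r hr => (hasDerivAt_ofReal_cpow (hpos r hr).1 a).hasDerivWithinAt) ?_
    Set.left_mem_uIcc Set.right_mem_uIcc
  · simpa using this
  · intro r hr
    obtain ⟨h0, h1, h2⟩ := hpos r hr
    have hw := abs_nonneg (t - l)
    rw [norm_mul, Complex.norm_cpow_eq_rpow_re_of_pos h0]
    gcongr
    have hq : r = r / l * l := by field_simp
    rw [hq, Real.mul_rpow (by positivity) hl0.le]
    simp only [Complex.sub_re, Complex.one_re]
    gcongr
    refine rpow_le_rpow_abs_of_inv_le (by positivity) ?_ ?_
    · rw [div_le_iff₀ hl0]; nlinarith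
    · rw [inv_div, div_le_iff₀ h0]; nlinarith

/-! ### The step remainder -/

theorem integrable_exp_neg_abs_div_four :
    MeasureTheory.Integrable (fun t : ℝ => Real.exp (-(|t| / 4))) := by
  have h1 : MeasureTheory.IntegrableOn (fun t : ℝ => Real.exp (-(|t| / 4))) (Set.Ioi 0) := by
    refine (integrableOn_exp_mul_Ioi (a := -(1 / 4)) (by norm_num) 0).congr_fun (fun t ht => ?_)
      measurableSet_Ioi
    simp only [abs_of_pos (show (0 : ℝ) < t from ht)]
    congr 1; ring
  have h2 : MeasureTheory.IntegrableOn (fun t : ℝ => Real.exp (-(|t| / 4))) (Set.Iic 0) := by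
    refine (integrableOn_exp_mul_Iic (a := 1 / 4) (by norm_num) 0).congr_fun (fun t ht => ?_)
      measurableSet_Iic
    simp only [abs_of_nonpos (show t ≤ (0 : ℝ) from ht)]
    congr 1; ring
  rw [← MeasureTheory.integrableOn_univ, ← Set.Iic_union_Ioi (a := (0 : ℝ))]
  exact h2.union h1

/-- The difference between `y / (e ^ t + y)` and the step function at `log ‖y‖`, weighted by
`t ^ (s - 1) - (log ‖y‖) ^ (s - 1)`. -/
noncomputable def stepRemainder (s y : ℂ) (t : ℝ) : ℂ :=
  ((t : ℂ) ^ (s - 1) - (Real.log ‖y‖ : ℂ) ^ (s - 1)) *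
    (y / (Complex.exp t + y) - (Set.Iio (Real.log ‖y‖)).indicator 1 t)

/-- For t ≥ l/2 the mean value bound on the powers supplies the factor |t - l|. For t < l/2 the
powers may be singular at 0 and are bounded separately, but there |t - l| ≥ l/2 makes the kernel
error exponentially small. -/
theorem norm_stepRemainder_le {s y : ℂ} (hl : 1 ≤ Real.log ‖y‖) {t : ℝ} (ht : 0 < t) :
    ‖stepRemainder s y t‖ ≤
      ‖s - 1‖ * (2 * (4 * |s.re - 2| + 1)) ^ |s.re - 2| * Real.log ‖y‖ ^ (s.re - 2) *
          Real.exp (-(|t - Real.log ‖y‖| / 4)) +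
        (Set.Ioc 0 (Real.log ‖y‖)).indicator (fun t : ℝ =>
          2 / Real.log ‖y‖ * Real.exp (-(Real.log ‖y‖ / 4)) *
          (t ^ (s.re - 1) + Real.log ‖y‖ ^ (s.re - 1))) t := by
  have hy : y ≠ 0 := by rintro rfl; simp at hl; linarith
  have hF := norm_div_exp_add_sub_indicator_mul_le hy t
  rw [stepRemainder, norm_mul]
  set l := Real.log ‖y‖ with hldef
  have hl0 : 0 < l := by linarith
  set D := ‖y / (Complex.exp t + y) - (Set.Iio l).indicator 1 t‖ with hD
  have hD0 : 0 ≤ D := norm_nonneg _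
  rcases le_or_gt (l / 2) t with h | h
  · refine le_add_of_le_of_nonneg ?_ (Set.indicator_nonneg (fun r hr => ?_) t)
    · have h1 := norm_ofReal_cpow_sub_le (s - 1) hl h
      have h2 := rpow_two_mul_one_add_le_mul_exp (abs_nonneg (s.re - 2)) (abs_nonneg (t - l))
      have h3 : (s - 1).re - 1 = s.re - 2 := by simp; ring
      rw [h3] at h1
      calc _ ≤ ‖s - 1‖ * ((2 * (1 + |t - l|)) ^ |s.re - 2| * l ^ (s.re - 2)) * |t - l| * D := by
            gcongr
        _ = ‖s - 1‖ * ((2 * (1 + |t - l|)) ^ |s.re - 2| * l ^ (s.re - 2)) * (D * |t - l|) := by ring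
        _ ≤ ‖s - 1‖ * (((2 * (4 * |s.re - 2| + 1)) ^ |s.re - 2| * Real.exp (|t - l| / 4)) *
            l ^ (s.re - 2)) * Real.exp (-(|t - l| / 2)) := by gcongr
        _ = ‖s - 1‖ * (2 * (4 * |s.re - 2| + 1)) ^ |s.re - 2| * l ^ (s.re - 2) *
            (Real.exp (|t - l| / 4) * Real.exp (-(|t - l| / 2))) := by ring
        _ = _ := by rw [← Real.exp_add]; congr 2; ring
    · have := hr.1
      positivity
  · refine le_add_of_nonneg_of_le (by positivity) ?_
    rw [Set.indicator_of_mem (show t ∈ Set.Ioc 0 l from ⟨ht, by linarith⟩)]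
    have h1 : ‖(t : ℂ) ^ (s - 1) - (l : ℂ) ^ (s - 1)‖ ≤ t ^ (s.re - 1) + l ^ (s.re - 1) := by
      refine (norm_sub_le _ _).trans_eq ?_
      rw [Complex.norm_cpow_eq_rpow_re_of_pos ht, Complex.norm_cpow_eq_rpow_re_of_pos hl0]
      simp
    have h2 : l / 2 ≤ |t - l| := by rw [abs_of_neg (by linarith)]; linarith
    have h3 : D ≤ 2 / l * Real.exp (-(l / 4)) := by
      have : D * (l / 2) ≤ Real.exp (-(l / 4)) :=
        (mul_le_mul_of_nonneg_left h2 hD0).trans (hF.trans (Real.exp_le_exp.mpr (by linarith)))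
      rw [div_mul_eq_mul_div, le_div_iff₀ hl0]
      linarith
    rw [mul_comm]
    gcongr

theorem integrable_stepRemainder_majorant (s : ℂ) (hs : 0 < s.re) {l : ℝ} (hl : 0 < l) :
    MeasureTheory.IntegrableOn (fun t : ℝ => t ^ (s.re - 1) + l ^ (s.re - 1)) (Set.Ioc 0 l) ∧
    ∫ t in Set.Ioc 0 l, (t ^ (s.re - 1) + l ^ (s.re - 1)) = (1 / s.re + 1) * l ^ s.re := by
  have h1 : IntervalIntegrable (fun t : ℝ => t ^ (s.re - 1)) MeasureTheory.volume 0 l :=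
    intervalIntegral.intervalIntegrable_rpow' (by linarith)
  have h2 : IntervalIntegrable (fun t : ℝ => l ^ (s.re - 1)) MeasureTheory.volume 0 l := by simp
  refine ⟨(intervalIntegrable_iff_integrableOn_Ioc_of_le hl.le).mp (h1.add h2), ?_⟩
  rw [← intervalIntegral.integral_of_le hl.le, intervalIntegral.integral_add h1 h2,
    integral_rpow (Or.inl (by linarith)), intervalIntegral.integral_const]
  rw [sub_add_cancel, Real.zero_rpow hs.ne', Real.rpow_sub_one hl.ne', smul_eq_mul]
  field_simp
  ring

theorem exists_norm_integral_stepRemainder_le (s : ℂ) (hs : 0 < s.re) :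
    ∃ C : ℝ, ∀ y : ℂ, 1 ≤ Real.log ‖y‖ →
      ‖∫ t in Set.Ioi (0 : ℝ), stepRemainder s y t‖ ≤ C * Real.log ‖y‖ ^ (s.re - 2) := by
  set K := ‖s - 1‖ * (2 * (4 * |s.re - 2| + 1)) ^ |s.re - 2| with hK
  have hK0 : 0 ≤ K := by positivity
  set A := ∫ t : ℝ, Real.exp (-(|t| / 4)) with hA
  refine ⟨K * A + 8 * (1 / s.re + 1), fun y hl => ?_⟩
  have hb := fun t (ht : t ∈ Set.Ioi (0 : ℝ)) => norm_stepRemainder_le (s := s) hl ht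
  rw [← hK] at hb
  set l := Real.log ‖y‖ with hldef
  have hl0 : 0 < l := by linarith
  have hi1 : MeasureTheory.Integrable (fun t : ℝ => Real.exp (-(|t - l| / 4))) :=
    integrable_exp_neg_abs_div_four.comp_sub_right l
  obtain ⟨hi2, he2⟩ := integrable_stepRemainder_majorant s hs hl0
  have hi3 : MeasureTheory.Integrable (Set.indicator (Set.Ioc 0 l) (fun t : ℝ =>
      2 / l * Real.exp (-(l / 4)) * (t ^ (s.re - 1) + l ^ (s.re - 1)))) :=
    (MeasureTheory.integrable_indicator_iff measurableSet_Ioc).mpr (hi2.const_mul _)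
  have hi4 := (hi1.const_mul (K * l ^ (s.re - 2)))
  refine (MeasureTheory.norm_integral_le_of_norm_le (hi4.add hi3).integrableOn
    ((MeasureTheory.ae_restrict_iff' measurableSet_Ioi).mpr (.of_forall hb))).trans ?_
  have hnn : ∀ t : ℝ, 0 ≤ (Set.indicator (Set.Ioc 0 l) (fun t : ℝ =>
      2 / l * Real.exp (-(l / 4)) * (t ^ (s.re - 1) + l ^ (s.re - 1)))) t := fun t =>
    Set.indicator_nonneg (fun r hr => by have := hr.1; positivity) t
  refine (MeasureTheory.setIntegral_le_integral (hi4.add hi3)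
    (.of_forall fun t => add_nonneg (by positivity) (hnn t))).trans ?_
  rw [MeasureTheory.integral_add' hi4 hi3, MeasureTheory.integral_const_mul,
    MeasureTheory.integral_indicator measurableSet_Ioc, MeasureTheory.integral_const_mul, he2,
    MeasureTheory.integral_sub_right_eq_self (fun t : ℝ => Real.exp (-(|t| / 4))) l, ← hA, add_mul (K * A)]
  refine add_le_add (by linarith) ?_
  -- Trades the exponential for one power of l; with the factor 2/l this lowers l^(re s) by two
  -- powers and yields the constant 8 = 2 · 4.
  have h5 : l * Real.exp (-(l / 4)) ≤ 4 := by
    have := Real.add_one_le_exp (l / 4)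
    rw [Real.exp_neg, ← div_eq_mul_inv, div_le_iff₀ (Real.exp_pos _)]
    linarith
  have h6 : l ^ s.re = l ^ (s.re - 2) * l * l := by
    rw [Real.rpow_sub hl0, Real.rpow_two]; field_simp
  rw [h6]
  calc _ = 2 * (1 / s.re + 1) * l ^ (s.re - 2) * (l * Real.exp (-(l / 4))) := by field_simp
    _ ≤ 2 * (1 / s.re + 1) * l ^ (s.re - 2) * 4 := by gcongr
    _ = _ := by ring

/-! ### Splitting the integral -/

theorem integral_cpow_mul_div_exp_add {s y : ℂ} (hs : 0 < s.re) (hy : y ∈ Complex.slitPlane)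
    (hl : 0 < Real.log ‖y‖) :
    ∫ t in Set.Ioi (0 : ℝ), (t : ℂ) ^ (s - 1) * (y / (Complex.exp t + y)) =
      (Real.log ‖y‖ : ℂ) ^ s / s +
        (Real.log ‖y‖ : ℂ) ^ (s - 1) * (Complex.log (1 + y) - Real.log ‖y‖) +
        ∫ t in Set.Ioi (0 : ℝ), stepRemainder s y t := by
  have hs0 : s ≠ 0 := by rintro rfl; simp at hs
  have hR : ∀ t : ℝ, stepRemainder s y t =
      ((t : ℂ) ^ (s - 1) * (y / (Complex.exp t + y)) -
        (Real.log ‖y‖ : ℂ) ^ (s - 1) * (y / (Complex.exp t + y))) -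
      (Set.Iio (Real.log ‖y‖)).indicator
        (fun t : ℝ => (t : ℂ) ^ (s - 1) - (Real.log ‖y‖ : ℂ) ^ (s - 1)) t := fun t => by
    rw [stepRemainder]
    by_cases h : t ∈ Set.Iio (Real.log ‖y‖)
    · simp only [Set.indicator_of_mem h, Pi.one_apply]; ring
    · simp only [Set.indicator_of_notMem h]; ring
  rw [MeasureTheory.integral_congr_ae (.of_forall hR)]
  set l := Real.log ‖y‖ with hldef
  have hc1 : IntervalIntegrable (fun t : ℝ => (t : ℂ) ^ (s - 1)) MeasureTheory.volume 0 l :=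
    intervalIntegral.intervalIntegrable_cpow' (by simpa using hs)
  have hc2 : IntervalIntegrable (fun _ : ℝ => (l : ℂ) ^ (s - 1)) MeasureTheory.volume 0 l := by simp
  have hset : Set.Iio l ∩ Set.Ioi 0 = Set.Ioo 0 l := by
    ext t; simp [and_comm]
  have hi1 := integrableOn_cpow_mul_div_exp_add hs hy
  have hi2 := (integrableOn_div_exp_add hy).const_mul ((l : ℂ) ^ (s - 1))
  have hi3 : MeasureTheory.IntegrableOn ((Set.Iio l).indicator
      (fun t : ℝ => (t : ℂ) ^ (s - 1) - (l : ℂ) ^ (s - 1))) (Set.Ioi 0) := by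
    rw [MeasureTheory.IntegrableOn, MeasureTheory.integrable_indicator_iff measurableSet_Iio,
      MeasureTheory.IntegrableOn, MeasureTheory.Measure.restrict_restrict measurableSet_Iio, hset]
    exact (intervalIntegrable_iff_integrableOn_Ioo_of_le hl.le).mp (hc1.sub hc2)
  rw [MeasureTheory.integral_sub (by exact hi1.sub hi2) hi3, MeasureTheory.integral_sub hi1 hi2,
    MeasureTheory.integral_const_mul, integral_div_exp_add hy,
    MeasureTheory.setIntegral_indicator measurableSet_Iio, Set.inter_comm, hset,
    ← MeasureTheory.integral_Ioc_eq_integral_Ioo, ← intervalIntegral.integral_of_le hl.le,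
    intervalIntegral.integral_sub hc1 hc2, integral_cpow (Or.inl (by simpa using hs)),
    intervalIntegral.integral_const]
  have hlc : (l : ℂ) ≠ 0 := by exact_mod_cast hl.ne'
  rw [sub_add_cancel, Complex.ofReal_zero, Complex.zero_cpow hs0, sub_zero, Complex.real_smul,
    sub_zero]
  ring

theorem polylog_eq_neg_inv_Gamma_mul_integral (s x : ℂ) :
    polylog s x = -((Complex.Gamma s)⁻¹ *
      ∫ t in Set.Ioi (0 : ℝ), (t : ℂ) ^ (s - 1) * (-x / (Complex.exp t + -x))) := by
  have h : ∀ t : ℝ, (t : ℂ) ^ (s - 1) * (-x / (Complex.exp t + -x)) =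
      -x * ((t : ℂ) ^ (s - 1) / (Complex.exp t - x)) := fun t => by
    rw [← sub_eq_add_neg]; ring
  simp only [h]
  rw [MeasureTheory.integral_const_mul, polylog]
  ring

/-! ### Expansions of the logarithm and of powers -/

/-- The segment from y to 1 + y moves to the right, so it stays in the slit plane and the mean value
inequality applies. -/
theorem norm_log_one_add_sub_log_le {y : ℂ} (hy : y ∈ Complex.slitPlane) (h1 : 1 < ‖y‖) :
    ‖Complex.log (1 + y) - Complex.log y‖ ≤ 1 / (‖y‖ - 1) := by
  have := (convex_Icc (0 : ℝ) 1).norm_image_sub_le_of_norm_hasDerivWithin_le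
    (f := fun r : ℝ => Complex.log (r + y)) (f' := fun r => 1 / ((r : ℂ) + y))
    (C := 1 / (‖y‖ - 1)) (x := 0) (y := 1) (fun r hr => ?_) (fun r hr => ?_) (by simp) (by simp)
  · simpa using this
  · refine HasDerivAt.hasDerivWithinAt ?_
    refine ((Complex.ofRealCLM.hasDerivAt (x := r)).add_const y).clog_real ?_
    rw [Complex.mem_slitPlane_iff] at hy ⊢
    simp only [Complex.ofRealCLM_apply, Complex.add_re, Complex.ofReal_re, Complex.add_im,
      Complex.ofReal_im, zero_add]
    exact hy.imp_left fun h => by linarith [hr.1]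
  · rw [norm_div, norm_one]
    refine one_div_le_one_div_of_le (by linarith) ?_
    have h2 := norm_sub_norm_le y (-(r : ℂ))
    rw [norm_neg, Complex.norm_real, Real.norm_of_nonneg hr.1, sub_neg_eq_add, add_comm y] at h2
    linarith [hr.2]

theorem isBigO_one_add_cpow_sub_linear (s : ℂ) :
    (fun z : ℂ => (1 + z) ^ s - 1 - s * z) =O[𝓝 0] fun z => z ^ 2 := by
  have hd : ∀ a z : ℂ, ‖z‖ < 1 →
      HasDerivAt (fun z : ℂ => (1 + z) ^ a) (a * (1 + z) ^ (a - 1)) z := fun a z hz => by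
    simpa using ((hasDerivAt_id z).const_add 1).cpow_const (c := a)
      (Complex.mem_slitPlane_of_norm_lt_one hz)
  have hO : (fun z : ℂ => s * ((1 + z) ^ (s - 1) - 1)) =O[𝓝 0] fun z => z := by
    simpa using (hd (s - 1) 0 (by simp)).isBigO_sub.const_mul_left s
  obtain ⟨C, hC⟩ := hO.bound
  obtain ⟨r, hr, hball⟩ := Metric.eventually_nhds_iff_ball.mp hC
  refine IsBigO.of_bound C ?_
  -- Radius r gives the bound O(w) on the derivative s((1+w)^(s-1) - 1); radius 1 keeps 1 + w off
  -- the branch cut.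
  filter_upwards [Metric.ball_mem_nhds (0 : ℂ) (lt_min hr one_pos)] with z hz
  rw [mem_ball_zero_iff] at hz
  have hle : ∀ w ∈ Metric.closedBall (0 : ℂ) ‖z‖, ‖w‖ ≤ ‖z‖ := fun w hw => by simpa using hw
  have hC0 : 0 ≤ C * ‖z‖ := by
    refine (norm_nonneg _).trans (hball z ?_)
    simpa using hz.trans_le (min_le_left _ _)
  have := (convex_closedBall (0 : ℂ) ‖z‖).norm_image_sub_le_of_norm_hasDerivWithin_le
    (f := fun z : ℂ => (1 + z) ^ s - 1 - s * z) (f' := fun z => s * ((1 + z) ^ (s - 1) - 1))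
    (C := C * ‖z‖) (x := 0) (y := z) (fun w hw => ?_) (fun w hw => ?_) (by simp) (by simp)
  · simpa [pow_two, mul_assoc] using this
  · have h1 := ((hd s w ((hle w hw).trans_lt (hz.trans_le (min_le_right _ _)))).sub_const 1).sub
      ((hasDerivAt_id w).const_mul s)
    exact (h1.congr_deriv (by ring)).hasDerivWithinAt
  · have hw' := hle w hw
    rcases (norm_nonneg z).eq_or_lt with h0 | h0
    · have : w = 0 := norm_le_zero_iff.mp (h0 ▸ hw')
      simpa [this] using hC0
    · have hCn : 0 ≤ C := nonneg_of_mul_nonneg_left hC0 h0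
      refine (hball w ?_).trans (by gcongr)
      simpa using hw'.trans_lt (hz.trans_le (min_le_left _ _))

theorem ofReal_mul_cpow {l : ℝ} (hl : 0 < l) {w : ℂ} (hw : w ≠ 0) (s : ℂ) :
    ((l : ℂ) * w) ^ s = (l : ℂ) ^ s * w ^ s := by
  have hlc : (l : ℂ) ≠ 0 := by exact_mod_cast hl.ne'
  rw [Complex.cpow_def_of_ne_zero (mul_ne_zero hlc hw), Complex.cpow_def_of_ne_zero hlc,
    Complex.cpow_def_of_ne_zero hw, Complex.log_ofReal_mul hl hw, ← Complex.exp_add,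
    Complex.ofReal_log hl.le, add_mul]

/-! ### Asymptotics at infinity off the ray -/

theorem tendsto_norm_toInftyOffRay : Tendsto (fun x : ℂ => ‖x‖) toInftyOffRay atTop :=
  tendsto_comap.mono_left inf_le_left

theorem tendsto_log_norm_toInftyOffRay :
    Tendsto (fun x : ℂ => Real.log ‖x‖) toInftyOffRay atTop :=
  Real.tendsto_log_atTop.comp tendsto_norm_toInftyOffRay

theorem eventually_neg_mem_slitPlane : ∀ᶠ x in toInftyOffRay, -x ∈ Complex.slitPlane := by
  refine mem_of_superset (mem_inf_of_right (mem_principal_self _)) fun x hx => ?_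
  rw [Set.mem_ofPred_eq, Complex.mem_slitPlane_iff, Complex.neg_re, Complex.neg_im, neg_pos, neg_ne_zero]
  by_contra! h
  exact hx x.re h.1 (Complex.ext (by simp) (by simp [h.2]))

/-- The relative deviation of `log (-x)` from its real part `log ‖x‖`. -/
noncomputable def logDeviation (x : ℂ) : ℂ :=
  (Complex.log (-x) - Real.log ‖x‖) / Real.log ‖x‖

/-- The numerator is i arg(-x), bounded by π in every direction. -/
theorem isBigO_logDeviation :
    logDeviation =O[toInftyOffRay] fun x => (Real.log ‖x‖)⁻¹ := by
  refine IsBigO.of_bound Real.pi (.of_forall fun x => ?_)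
  have h : Complex.log (-x) - Real.log ‖x‖ = Complex.arg (-x) * Complex.I := by
    rw [Complex.log, norm_neg]; ring
  rw [logDeviation, h, norm_div, norm_mul, Complex.norm_I, mul_one, Complex.norm_real,
    Complex.norm_real, norm_inv, ← div_eq_mul_inv]
  gcongr
  exact Complex.abs_arg_le_pi _

theorem tendsto_logDeviation : Tendsto logDeviation toInftyOffRay (𝓝 0) :=
  isBigO_logDeviation.trans_tendsto (tendsto_inv_atTop_zero.comp tendsto_log_norm_toInftyOffRay)

theorem eventually_log_neg_cpow_eq (s : ℂ) : ∀ᶠ x in toInftyOffRay,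
    Complex.log (-x) ^ s = (Real.log ‖x‖ : ℂ) ^ s * (1 + logDeviation x) ^ s := by
  filter_upwards [tendsto_log_norm_toInftyOffRay.eventually_gt_atTop 0,
    tendsto_logDeviation.eventually (Metric.ball_mem_nhds (0 : ℂ) one_pos)] with x hx hz
  rw [← ofReal_mul_cpow hx
    (Complex.slitPlane_ne_zero (Complex.mem_slitPlane_of_norm_lt_one (by simpa using hz)))]
  have : (Real.log ‖x‖ : ℂ) ≠ 0 := by exact_mod_cast hx.ne'
  congr 1
  rw [logDeviation]
  field_simp
  ring

/-- Up to `O((log ‖x‖) ^ (re s - 2))`, the polylogarithm is `-(log (-x)) ^ s / Γ(s + 1)`. -/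
theorem isBigO_polylog_sub {s : ℂ} (hs : 0 < s.re) :
    (fun x : ℂ => polylog s x - -(Complex.log (-x)) ^ s / Complex.Gamma (s + 1))
      =O[toInftyOffRay] fun x => Real.log ‖x‖ ^ (s.re - 2) := by
  have hs0 : s ≠ 0 := by rintro rfl; simp at hs
  have hG : Complex.Gamma s ≠ 0 := Complex.Gamma_ne_zero_of_re_pos hs
  have hl := tendsto_log_norm_toInftyOffRay
  have h1 : (fun x : ℂ => (Real.log ‖x‖ : ℂ) ^ s *
      ((1 + logDeviation x) ^ s - 1 - s * logDeviation x))
      =O[toInftyOffRay] fun x => Real.log ‖x‖ ^ (s.re - 2) := by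
    have ha : (fun x : ℂ => (Real.log ‖x‖ : ℂ) ^ s)
        =O[toInftyOffRay] fun x => Real.log ‖x‖ ^ s.re := by
      refine IsBigO.of_bound 1 ?_
      filter_upwards [hl.eventually_gt_atTop 0] with x hx
      rw [Complex.norm_cpow_eq_rpow_re_of_pos hx, one_mul]
      exact le_abs_self _
    have hb := ((isBigO_one_add_cpow_sub_linear s).comp_tendsto tendsto_logDeviation).trans
      (isBigO_logDeviation.pow 2)
    refine (ha.mul hb).congr' .rfl ?_
    filter_upwards [hl.eventually_gt_atTop 0] with x hx
    rw [Real.rpow_sub hx, Real.rpow_two]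
    field_simp
  have h2 : (fun x : ℂ => (Real.log ‖x‖ : ℂ) ^ (s - 1) *
      (Complex.log (1 + -x) - Complex.log (-x)))
      =O[toInftyOffRay] fun x => Real.log ‖x‖ ^ (s.re - 2) := by
    refine IsBigO.of_bound 1 ?_
    filter_upwards [hl.eventually_gt_atTop 0, eventually_neg_mem_slitPlane,
      tendsto_norm_toInftyOffRay.eventually_gt_atTop 1] with x hx hsl hx1
    have h3 := norm_log_one_add_sub_log_le hsl (by simpa using hx1)
    rw [norm_neg] at h3
    have h4 : Real.log ‖x‖ ≤ ‖x‖ - 1 := Real.log_le_sub_one_of_pos (by linarith)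
    rw [norm_mul, Complex.norm_cpow_eq_rpow_re_of_pos hx, one_mul,
      Real.norm_of_nonneg (by positivity), show s.re - 2 = (s.re - 1) - 1 by ring,
      Real.rpow_sub_one hx.ne', div_eq_mul_one_div, Complex.sub_re, Complex.one_re]
    gcongr
    exact h3.trans (one_div_le_one_div_of_le hx h4)
  have h3 : (fun x : ℂ => ∫ t in Set.Ioi (0 : ℝ), stepRemainder s (-x) t)
      =O[toInftyOffRay] fun x => Real.log ‖x‖ ^ (s.re - 2) := by
    obtain ⟨C, hC⟩ := exists_norm_integral_stepRemainder_le s hs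
    refine IsBigO.of_bound C ?_
    filter_upwards [hl.eventually_ge_atTop 1] with x hx
    have := hC (-x) (by simpa using hx)
    rw [norm_neg] at this
    rwa [Real.norm_of_nonneg (by positivity)]
  -- The linear Taylor term cancels l^(s-1) (log(-x) - l), as l · `logDeviation x` = log(-x) - l;
  -- only the three estimated errors survive.
  refine ((((h1.const_mul_left s⁻¹).sub h2).sub h3).const_mul_left (Complex.Gamma s)⁻¹).congr' ?_ .rfl
  filter_upwards [hl.eventually_gt_atTop 0, eventually_neg_mem_slitPlane,
    eventually_log_neg_cpow_eq s] with x hx hsl hcpow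
  have hlc : (Real.log ‖x‖ : ℂ) ≠ 0 := by exact_mod_cast hx.ne'
  rw [polylog_eq_neg_inv_Gamma_mul_integral, integral_cpow_mul_div_exp_add hs hsl (by simpa using hx),
    hcpow, Complex.Gamma_add_one s hs0, norm_neg, Complex.cpow_sub _ _ hlc, Complex.cpow_one]
  have hz : Complex.log (-x) = Real.log ‖x‖ * (1 + logDeviation x) := by
    rw [logDeviation]; field_simp; ring
  rw [hz]
  field_simp
  ring

theorem corollary3p2 (s : ℂ) (hs : 0 < s.re) :
    (fun x : ℂ => polylog s x) ~[toInftyOffRay]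
        (fun x : ℂ => -(Complex.log (-x)) ^ s / Complex.Gamma (s + 1)) ∧
      (s.re < 2 →
        (fun x : ℂ => polylog s x - -(Complex.log (-x)) ^ s / Complex.Gamma (s + 1))
          =o[toInftyOffRay] (fun _ : ℂ => (1 : ℝ))) := by
  have hl := tendsto_log_norm_toInftyOffRay
  refine ⟨?_, fun h2 => ?_⟩
  · have h1 : (fun x : ℂ => Real.log ‖x‖ ^ (s.re - 2))
        =o[toInftyOffRay] fun x => Real.log ‖x‖ ^ s.re := by
      have h0 := (isLittleO_one_iff ℝ).mpr
        ((tendsto_rpow_neg_atTop (show (0 : ℝ) < 2 by norm_num)).comp hl)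
      refine ((isBigO_refl (fun x : ℂ => Real.log ‖x‖ ^ s.re) _).mul_isLittleO h0).congr' ?_
        (.of_forall fun x => mul_one _)
      filter_upwards [hl.eventually_gt_atTop 0] with x hx
      rw [Function.comp_apply, ← Real.rpow_add hx, sub_eq_add_neg]
    have hcpow : Tendsto (fun x => (1 + logDeviation x) ^ s) toInftyOffRay (𝓝 1) := by
      simpa using (tendsto_logDeviation.const_add 1).cpow tendsto_const_nhds (b := s) (by simp)
    have h2 : (fun x : ℂ => Real.log ‖x‖ ^ s.re) =O[toInftyOffRay]
        fun x : ℂ => -(Complex.log (-x)) ^ s / Complex.Gamma (s + 1) := by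
      have hG : Complex.Gamma (s + 1) ≠ 0 :=
        Complex.Gamma_ne_zero_of_re_pos (by simp; linarith)
      -- The 2 comes from ‖(1 + `logDeviation x`)^s‖ > 1/2 eventually, since this power tends to 1.
      refine IsBigO.of_bound (2 * ‖Complex.Gamma (s + 1)‖) ?_
      filter_upwards [hl.eventually_gt_atTop 0, eventually_log_neg_cpow_eq s,
        hcpow.norm.eventually (lt_mem_nhds (show (1 / 2 : ℝ) < ‖(1 : ℂ)‖ by norm_num))]
        with x hx he hhalf
      rw [he, norm_div, norm_neg, norm_mul, Complex.norm_cpow_eq_rpow_re_of_pos hx,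
        Real.norm_of_nonneg (by positivity)]
      have hGn : 0 < ‖Complex.Gamma (s + 1)‖ := norm_pos_iff.mpr hG
      have hr : 0 < Real.log ‖x‖ ^ s.re := by positivity
      field_simp
      linarith
    exact ((isBigO_polylog_sub hs).trans_isLittleO h1).trans_isBigO h2
  · refine (isBigO_polylog_sub hs).trans_isLittleO ((isLittleO_one_iff ℝ).mpr ?_)
    have := (tendsto_rpow_neg_atTop (show 0 < 2 - s.re by linarith)).comp hl
    simpa [Function.comp_def] using this
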